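/- Let $n\ge 2$, let $M_0$ be a connected smooth manifold of dimension $n-1$, $I\subset\mathbb R$ an open interval, and $M=M_0\times I$ with product net $\mathcal E=(E_0,E_1)$, where $E_0$, $E_1$ are the distributions tangent to the factors $M_0$, $I$; let $s$ be the coordinate of $I$. A \emph{hypersurface of Enneper type} on an open set $U\subset M$ with Gauss map $N$ is a smooth immersion $f\colon U\to\mathbb R^{n+1}$ with smooth unit normal $N$ such that (i) $E_0\perp E_1$ for the metric induced by $f$; (ii) the second fundamental form of $f$ satisfies $\mathrm{II}(E_0,E_1)=0$; (iii') for each $s$ the set $f(U\cap(M_0\times\{s\}))$ is contained in a hypersphere of $\mathbb R^{n+1}$. Let $N\colon M\to\mathbb S^n$ be a smooth local diffeomorphism. The product net is orthogonal for the metric $d\sigma^2$ induced by $N$ if and only if $d\sigma^2=g_s+\rho^2ds^2$ for some $\rho\in C^\infty(M)$, where $g_s$ is the metric induced by $N$ on the leaf $M_0\times\{s\}$. Let $\rho\in C^\infty(M)$ be any function as in this formula. \emph{Direct statement.} Suppose that the net is orthogonal for $d\sigma^2$. If $\gamma\colon I\to\mathbb R^{n+1}$ and $\alpha,\beta\colon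 I\to\mathbb R$ are smooth and $$\langle\gamma',N\rangle+\alpha'=\beta\rho \quad\text{on } M, \qquad (1)$$ then the map $$f=\gamma+\alpha N+\beta\rho^{-1}N_*\partial_s \qquad (2)$$ is, on the open set of its regular points, a hypersurface of Enneper type with Gauss map $N$, and the hyperspheres in (iii') can be taken with centres $\gamma(s)$. \emph{Converse.} Let $f\colon M\to\mathbb R^{n+1}$ be a hypersurface of Enneper type with Gauss map $N$. Then the net is orthogonal for $d\sigma^2$ and: (a) for every smooth curve $\gamma\colon I\to\mathbb R^{n+1}$ such that each $f(M_0\times\{s\})$ lies in a hypersphere with centre $\gamma(s)$, there are $\alpha,\beta\in C^\infty(I)$ such that (1) and (2) hold on $M$; (b) in general (no smooth choice of the centres being assumed), there are an open set $J\subset I$ dense in $I$, containing every $s\in I$ for which $f(M_0\times\{s\})$ lies in no affine hyperplane, and smooth $\gamma\colon J\to\mathbb R^{n+1}$, $\alpha,\beta\colon J\to\mathbb R$ such that (1) and (2) hold on $M_0\times J$. In particular, if no $f(M_0\times\{s\})$ lies in an affine hyperplane, then (1) and (2) hold on all of $M$ for a smooth triple $(\gamma,\alpha,\beta)$. -/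

import Mathlib

open scoped Manifold ContDiff

noncomputable section

namespace EnneperType

/-- The ambient Euclidean space `ℝ^{n+1}`, where `n = m + 1` and `m = n - 1 = dim M₀`. -/
abbrev Amb (m : ℕ) : Type := EuclideanSpace ℝ (Fin (m + 2))

/-- The unit sphere `𝕊^n ⊆ ℝ^{n+1}`, `n = m + 1`. -/
abbrev USphere (m : ℕ) : Type := Metric.sphere (0 : Amb m) 1

/-- A tangent vector `(X, r)` of `M₀ × ℝ`: `X` is tangent to `M₀` and `r` stands for `r ∂_s`.
The product net is `E₀ = {(X, 0)}`, `E₁ = {(0, r)}`, and `∂_s = (0, 1)`. -/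
abbrev TVec (m : ℕ) : Type := EuclideanSpace ℝ (Fin m) × ℝ

/-- The product manifold `M = M₀ × I` as a subset of `M₀ × ℝ`. Maps on `M` are given by maps on
`M₀ × ℝ`, whose values outside `M` play no role. -/
def prodDomain (M₀ : Type*) (I : Set ℝ) : Set (M₀ × ℝ) := Set.univ ×ˢ I

section

variable {m : ℕ} {M₀ : Type*} [TopologicalSpace M₀] [ChartedSpace (EuclideanSpace ℝ (Fin m)) M₀]

/-- The differential `f_*` at `p` of a vector valued map `f`. -/
def diffAt (f : M₀ × ℝ → Amb m) (p : M₀ × ℝ) : TVec m →L[ℝ] Amb m :=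
  mfderiv ((𝓡 m).prod 𝓘(ℝ, ℝ)) 𝓘(ℝ, Amb m) f p

/-- Smoothness on `U` of a map from `M₀ × ℝ` to a normed space. -/
def SmoothOn {F : Type*} [NormedAddCommGroup F] [NormedSpace ℝ F]
    (f : M₀ × ℝ → F) (U : Set (M₀ × ℝ)) : Prop :=
  ContMDiffOn ((𝓡 m).prod 𝓘(ℝ, ℝ)) 𝓘(ℝ, F) ∞ f U

/-- The metric induced by `f`: `⟨f_* v, f_* w⟩`. -/
def inducedMetric (f : M₀ × ℝ → Amb m) (p : M₀ × ℝ) (v w : TVec m) : ℝ :=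
  inner ℝ (diffAt f p v) (diffAt f p w)

/-- `f` is a smooth immersion on `U`. -/
def IsImmersedOn (f : M₀ × ℝ → Amb m) (U : Set (M₀ × ℝ)) : Prop :=
  SmoothOn (m := m) f U ∧ ∀ p ∈ U, Function.Injective (diffAt f p)

/-- `ν` is a Gauss map of `f` on `U`, that is, a smooth unit normal vector field along `f`. -/
def IsGaussMapOn (f ν : M₀ × ℝ → Amb m) (U : Set (M₀ × ℝ)) : Prop :=
  SmoothOn (m := m) ν U ∧ ∀ p ∈ U, ‖ν p‖ = 1 ∧ ∀ v : TVec m, inner ℝ (diffAt f p v) (ν p) = 0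

/-- The second fundamental form `⟨A v, w⟩` of `f` with respect to the Gauss map `ν`, where the
shape operator `A` is determined by `f_* A v = - ν_* v`. -/
def secondFundForm (f ν : M₀ × ℝ → Amb m) (p : M₀ × ℝ) (v w : TVec m) : ℝ :=
  -inner ℝ (diffAt ν p v) (diffAt f p w)

/-- The product net is orthogonal with respect to the metric induced by `f`. -/
def NetOrthogonalOn (f : M₀ × ℝ → Amb m) (U : Set (M₀ × ℝ)) : Prop :=
  ∀ p ∈ U, ∀ (X : EuclideanSpace ℝ (Fin m)) (r : ℝ), inducedMetric f p (X, 0) (0, r) = 0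

/-- The second fundamental form of `f` is adapted to the product net. -/
def SecondFormAdaptedOn (f ν : M₀ × ℝ → Amb m) (U : Set (M₀ × ℝ)) : Prop :=
  ∀ p ∈ U, ∀ (X : EuclideanSpace ℝ (Fin m)) (r : ℝ), secondFundForm f ν p (X, 0) (0, r) = 0

/-- For each `s`, the image by `f` of the part in `U` of the leaf `M₀ × {s}` of `E₀` is contained
in a hypersphere with centre `c s`. -/
def LeavesInSpheresCentred (f : M₀ × ℝ → Amb m) (U : Set (M₀ × ℝ)) (c : ℝ → Amb m) : Prop :=
  ∀ s : ℝ, ∃ R : ℝ, 0 < R ∧ ∀ x : M₀, (x, s) ∈ U → f (x, s) ∈ Metric.sphere (c s) R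

/-- `f`, restricted to the open subset `U`, is a hypersurface of Enneper type with respect to the
product net, having `ν` as a Gauss map. Nothing is assumed in the field `spherical` about the
dependence on `s` of the hypersphere that contains the image of the leaf `M₀ × {s}`. -/
structure IsEnneperOn (f ν : M₀ × ℝ → Amb m) (U : Set (M₀ × ℝ)) : Prop where
  immersed : IsImmersedOn f U
  gauss : IsGaussMapOn f ν U
  orthogonal : NetOrthogonalOn f U
  adapted : SecondFormAdaptedOn f ν U
  spherical : ∃ c : ℝ → Amb m, LeavesInSpheresCentred f U c

/-- The map `N` into the sphere, followed by the inclusion into `ℝ^{n+1}`. -/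
def toAmb (N : M₀ × ℝ → USphere m) : M₀ × ℝ → Amb m := fun p => (N p : Amb m)

/-- `ρ` is a smooth function on `U` such that the metric induced by `N` is `g_s + ρ² ds²`
there, where `g_s` is the metric induced on the leaf `M₀ × {s}`. -/
def MetricSplitsOn (N : M₀ × ℝ → USphere m) (ρ : M₀ × ℝ → ℝ) (U : Set (M₀ × ℝ)) : Prop :=
  SmoothOn (m := m) ρ U ∧ ∀ p ∈ U, ∀ (X Y : EuclideanSpace ℝ (Fin m)) (a b : ℝ),
    inducedMetric (toAmb N) p (X, a) (Y, b) =
      inducedMetric (toAmb N) p (X, 0) (Y, 0) + ρ p ^ 2 * (a * b)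

/-- The map `γ + α N + β ρ⁻¹ N_* ∂_s`. -/
def enneperMap (N : M₀ × ℝ → USphere m) (ρ : M₀ × ℝ → ℝ) (γ : ℝ → Amb m) (α β : ℝ → ℝ) :
    M₀ × ℝ → Amb m := fun p =>
  γ p.2 + α p.2 • toAmb N p + (β p.2 * (ρ p)⁻¹) • diffAt (toAmb N) p (0, 1)

/-- `γ`, `α`, `β` are smooth on `I` and satisfy `⟨γ', N⟩ + α' = β ρ` on `M₀ × I`. -/
def IsEnneperTriple (N : M₀ × ℝ → USphere m) (ρ : M₀ × ℝ → ℝ) (I : Set ℝ)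
    (γ : ℝ → Amb m) (α β : ℝ → ℝ) : Prop :=
  ContDiffOn ℝ ∞ γ I ∧ ContDiffOn ℝ ∞ α I ∧ ContDiffOn ℝ ∞ β I ∧
    ∀ p ∈ prodDomain M₀ I,
      inner ℝ (deriv γ p.2) (toAmb N p) + deriv α p.2 = β p.2 * ρ p

/-- The set of regular points in `U` of a map `f`. -/
def regularPoints (f : M₀ × ℝ → Amb m) (U : Set (M₀ × ℝ)) : Set (M₀ × ℝ) :=
  {p ∈ U | Function.Injective (diffAt f p)}

end

end EnneperType

end

open scoped Topology

noncomputable section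

namespace EnneperType

/-! ### Calculus on `M₀ × ℝ` in a chart of `M₀` -/

section Calculus

variable {m : ℕ} {M₀ : Type*} [TopologicalSpace M₀] [ChartedSpace (EuclideanSpace ℝ (Fin m)) M₀]
  {F : Type*} [NormedAddCommGroup F] [NormedSpace ℝ F]

/-! Put T = ρ⁻¹ ∂_s N. If the net is orthogonal for the metric of N, then N and T are orthonormal
and span the orthogonal complement of N_*E₀ (`IsNetFrame`). Differentiating the relations |N| = |T|
= 1, ⟨N, T⟩ = 0 along a leaf shows that T_*E₀ is orthogonal to N and T as well.

Direct statement (`IsNetFrame.isEnneperOn`): along a leaf γ, α, β are constant, so f_*X = α N_*X + β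
T_*X is orthogonal to N and T, and |f - γ|² = α² + β² there. Equation (1) says precisely that ∂_s f
is orthogonal to N. Symmetry of the second fundamental form turns f_*X ⟂ ∂_s N into N_*X ⟂ ∂_s f.
Hence ∂_s f is a multiple of T, and so orthogonal to f_*E₀.

Converse (`IsEnneperOn.netOrthogonalOn_gauss`, `IsNetFrame.exists_triple`): by the same symmetry ∂_s
N is orthogonal to f_*E₀ and to N, so it is a multiple of ∂_s f, which is orthogonal to N_*E₀; the
net is therefore orthogonal for N. If γ(s) is a centre, f - γ is orthogonal to f_*E₀, so it equals
αN + βT. The coefficients have zero derivative along the connected leaves, and ⟨∂_s f, N⟩ = 0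
becomes (1).

Missing smoothness of the centres (`exists_smooth_centre`): a centre is unique up to the orthogonal
complement of the direction of the affine span of the leaf's image. The centre within that span is
given by an invertible Gram system, smooth wherever the dimension of the span is locally constant.
This dimension is lower semicontinuous and bounded, so that happens on an open dense set. -/

/-- The expression of `f` in the preferred chart of `M₀` at `x`. -/
def chartRep (x : M₀) (f : M₀ × ℝ → F) : TVec m → F :=
  fun q => f ((extChartAt (𝓡 m) x).symm q.1, q.2)

/-- The differential at `p` of a map into a normed space. -/
def vdiff (f : M₀ × ℝ → F) (p : M₀ × ℝ) : TVec m →L[ℝ] F :=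
  mfderiv ((𝓡 m).prod 𝓘(ℝ, ℝ)) 𝓘(ℝ, F) f p

/-- The partial derivative in the direction of the factor `ℝ`. -/
def sDeriv (f : M₀ × ℝ → F) (p : M₀ × ℝ) : F := deriv (fun t => f (p.1, t)) p.2

/-- The curve through `x` which is the straight line of direction `X` in the preferred chart. -/
def chartLine (x : M₀) (X : EuclideanSpace ℝ (Fin m)) (t : ℝ) : M₀ :=
  (extChartAt (𝓡 m) x).symm (extChartAt (𝓡 m) x x + t • X)

theorem chartLine_zero (x : M₀) (X : EuclideanSpace ℝ (Fin m)) : chartLine x X 0 = x := by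
  simp [chartLine]

/-- The product chart is the chart of `M₀` times the identity of `ℝ`, so `chartRep x f` is by
definition the coordinate expression entering `mfderiv`; the model has no boundary, so the
derivative within its range is a full derivative. -/
theorem hasFDerivAt_chartRep {f : M₀ × ℝ → F} {x : M₀} {s : ℝ}
    (hf : ContMDiffAt ((𝓡 m).prod 𝓘(ℝ, ℝ)) 𝓘(ℝ, F) ∞ f (x, s)) :
    HasFDerivAt (chartRep x f) (vdiff (m := m) f (x, s)) (extChartAt (𝓡 m) x x, s) := by
  have h : HasFDerivWithinAt (chartRep x f) (vdiff (m := m) f (x, s))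
      (Set.range ((𝓡 m).prod 𝓘(ℝ, ℝ))) (extChartAt (𝓡 m) x x, s) :=
    (hf.mdifferentiableAt (by simp)).hasMFDerivAt.2
  rwa [ModelWithCorners.range_eq_univ, hasFDerivWithinAt_univ] at h

theorem contMDiffAt_iff_chartRep {f : M₀ × ℝ → F} {x : M₀} {s : ℝ} :
    ContMDiffAt ((𝓡 m).prod 𝓘(ℝ, ℝ)) 𝓘(ℝ, F) ∞ f (x, s) ↔
      ContDiffAt ℝ ∞ (chartRep x f) (extChartAt (𝓡 m) x x, s) := by
  rw [contMDiffAt_iff, ModelWithCorners.range_eq_univ, contDiffWithinAt_univ]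
  constructor
  · exact fun h => h.2
  · intro h
    refine ⟨?_, h⟩
    have h1 : ContinuousAt (fun p : M₀ × ℝ => chartRep x f (extChartAt (𝓡 m) x p.1, p.2)) (x, s) :=
      ContinuousAt.comp (f := fun p : M₀ × ℝ => (extChartAt (𝓡 m) x p.1, p.2))
        (g := chartRep x f) (x := (x, s)) h.continuousAt
        ((ContinuousAt.comp (f := Prod.fst) (x := (x, s)) (continuousAt_extChartAt (I := 𝓡 m) x)
          continuousAt_fst).prodMk continuousAt_snd)
    refine h1.congr ?_
    have h2 : ∀ᶠ p : M₀ × ℝ in 𝓝 (x, s), p.1 ∈ (extChartAt (𝓡 m) x).source :=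
      continuousAt_fst.eventually (extChartAt_source_mem_nhds (I := 𝓡 m) x)
    filter_upwards [h2] with p hp
    simp only [chartRep, (extChartAt (𝓡 m) x).left_inv hp]

theorem hasDerivAt_chartLine {f : M₀ × ℝ → F} {x : M₀} {s : ℝ}
    (hf : ContMDiffAt ((𝓡 m).prod 𝓘(ℝ, ℝ)) 𝓘(ℝ, F) ∞ f (x, s)) (X : EuclideanSpace ℝ (Fin m)) :
    HasDerivAt (fun t => f (chartLine x X t, s)) (vdiff (m := m) f (x, s) (X, 0)) 0 := by
  have h := hasFDerivAt_chartRep hf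
  have hl : HasDerivAt (fun t : ℝ => ((extChartAt (𝓡 m) x x + t • X, s) : TVec m)) (X, 0) 0 := by
    have : HasDerivAt (fun t : ℝ => extChartAt (𝓡 m) x x + t • X) X 0 := by
      simpa using ((hasDerivAt_id (0 : ℝ)).smul_const X).const_add (extChartAt (𝓡 m) x x)
    exact this.prodMk (hasDerivAt_const _ _)
  have h0 : ((extChartAt (𝓡 m) x x + (0 : ℝ) • X, s) : TVec m) = (extChartAt (𝓡 m) x x, s) := by
    simp
  rw [← h0] at h
  exact h.comp_hasDerivAt (0 : ℝ) hl

theorem hasDerivAt_snd {f : M₀ × ℝ → F} {x : M₀} {s : ℝ}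
    (hf : ContMDiffAt ((𝓡 m).prod 𝓘(ℝ, ℝ)) 𝓘(ℝ, F) ∞ f (x, s)) :
    HasDerivAt (fun t => f (x, t)) (vdiff (m := m) f (x, s) (0, 1)) s := by
  have h := hasFDerivAt_chartRep hf
  have hl : HasDerivAt (fun t : ℝ => ((extChartAt (𝓡 m) x x, t) : TVec m)) (0, 1) s :=
    (hasDerivAt_const _ _).prodMk (hasDerivAt_id s)
  have := h.comp_hasDerivAt s hl
  refine this.congr_of_eventuallyEq (Filter.Eventually.of_forall fun t => ?_)
  simp [chartRep]

theorem vdiff_zero_one {f : M₀ × ℝ → F} {p : M₀ × ℝ}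
    (hf : ContMDiffAt ((𝓡 m).prod 𝓘(ℝ, ℝ)) 𝓘(ℝ, F) ∞ f p) :
    vdiff (m := m) f p (0, 1) = sDeriv f p :=
  (hasDerivAt_snd (x := p.1) (s := p.2) hf).deriv.symm

theorem vdiff_mk {f : M₀ × ℝ → F} {p : M₀ × ℝ}
    (hf : ContMDiffAt ((𝓡 m).prod 𝓘(ℝ, ℝ)) 𝓘(ℝ, F) ∞ f p) (X : EuclideanSpace ℝ (Fin m)) (r : ℝ) :
    vdiff (m := m) f p (X, r) = vdiff (m := m) f p (X, 0) + r • sDeriv f p := by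
  rw [← vdiff_zero_one hf, ← map_smul, ← map_add]
  simp

theorem eventually_differentiableAt_of_contDiffAt {E : Type*} [NormedAddCommGroup E] [NormedSpace ℝ E]
    {g : E → F} {q : E} (hg : ContDiffAt ℝ ∞ g q) : ∀ᶠ q' in 𝓝 q, DifferentiableAt ℝ g q' := by
  have := (hg.of_le (m := 1) (by exact_mod_cast le_top)).eventually (by simp)
  exact this.mono fun q' h => h.differentiableAt (by simp)

/-- The chart leaves the `ℝ` coordinate alone, so `∂_s` is a coordinate derivative. This makes
`sDeriv f` smooth and reduces mixed derivatives to second derivatives of one function on a vector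
space. -/
theorem chartRep_sDeriv_eventuallyEq {f : M₀ × ℝ → F} {x : M₀} {s : ℝ}
    (hf : ContMDiffAt ((𝓡 m).prod 𝓘(ℝ, ℝ)) 𝓘(ℝ, F) ∞ f (x, s)) :
    chartRep x (sDeriv f) =ᶠ[𝓝 (extChartAt (𝓡 m) x x, s)]
      fun q => fderiv ℝ (chartRep x f) q (0, 1) := by
  filter_upwards [eventually_differentiableAt_of_contDiffAt (contMDiffAt_iff_chartRep.1 hf)] with q hq
  have hl : HasDerivAt (fun t : ℝ => ((q.1, t) : TVec m)) (0, 1) q.2 :=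
    (hasDerivAt_const _ _).prodMk (hasDerivAt_id _)
  exact (hq.hasFDerivAt.comp_hasDerivAt q.2 hl).deriv

theorem contMDiffAt_sDeriv {f : M₀ × ℝ → F} {p : M₀ × ℝ}
    (hf : ContMDiffAt ((𝓡 m).prod 𝓘(ℝ, ℝ)) 𝓘(ℝ, F) ∞ f p) :
    ContMDiffAt ((𝓡 m).prod 𝓘(ℝ, ℝ)) 𝓘(ℝ, F) ∞ (sDeriv f) p := by
  obtain ⟨x, s⟩ := p
  rw [contMDiffAt_iff_chartRep]
  refine ContDiffAt.congr_of_eventuallyEq ?_ (chartRep_sDeriv_eventuallyEq hf)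
  exact ((contMDiffAt_iff_chartRep.1 hf).fderiv_right (m := ∞) (by simp)).clm_apply
    contDiffAt_const

/-- Symmetry of the mixed second derivative. -/
theorem hasDerivAt_vdiff_snd {f : M₀ × ℝ → F} {I : Set ℝ} (hI : IsOpen I)
    (hf : ∀ p ∈ prodDomain M₀ I, ContMDiffAt ((𝓡 m).prod 𝓘(ℝ, ℝ)) 𝓘(ℝ, F) ∞ f p)
    {x : M₀} {s : ℝ} (hs : s ∈ I) (X : EuclideanSpace ℝ (Fin m)) :
    HasDerivAt (fun t => vdiff (m := m) f (x, t) (X, 0))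
      (vdiff (m := m) (sDeriv f) (x, s) (X, 0)) s := by
  have hfs := hf (x, s) ⟨trivial, hs⟩
  set G := chartRep (m := m) x f with hG
  set y := extChartAt (𝓡 m) x x with hy
  have hGs : ContDiffAt ℝ ∞ G (y, s) := contMDiffAt_iff_chartRep.1 hfs
  have hd : HasFDerivAt (fderiv ℝ G) (fderiv ℝ (fderiv ℝ G) (y, s)) (y, s) :=
    ((hGs.fderiv_right (m := ∞) (by simp)).differentiableAt
      (by simp)).hasFDerivAt
  have hsymm : IsSymmSndFDerivAt ℝ G (y, s) :=
    hGs.isSymmSndFDerivAt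
      (by simpa using (WithTop.coe_le_coe.2 le_top : ((2 : ℕ∞) : WithTop ℕ∞) ≤ ∞))
  have h1 : vdiff (m := m) (sDeriv f) (x, s) = fderiv ℝ (chartRep x (sDeriv f)) (y, s) :=
    (hasFDerivAt_chartRep (contMDiffAt_sDeriv hfs)).fderiv.symm
  have h2 : fderiv ℝ (chartRep x (sDeriv f)) (y, s) (X, 0)
      = fderiv ℝ (fderiv ℝ G) (y, s) (0, 1) (X, 0) := by
    rw [(chartRep_sDeriv_eventuallyEq hfs).fderiv_eq, hsymm.eq]
    have := hd.clm_apply (hasFDerivAt_const ((0, 1) : TVec m) (y, s))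
    rw [this.fderiv]
    simp
  rw [h1, h2]
  have hl : HasDerivAt (fun t : ℝ => ((y, t) : TVec m)) (0, 1) s :=
    (hasDerivAt_const _ _).prodMk (hasDerivAt_id _)
  have h3 := (hd.comp_hasDerivAt s hl).clm_apply (hasDerivAt_const s ((X, 0) : TVec m))
  simp only [map_zero, add_zero] at h3
  refine h3.congr_of_eventuallyEq ?_
  -- The chart depends on `x` only, so the same `G` computes the differential at all points `(x,
  -- t)`.
  filter_upwards [hI.mem_nhds hs] with t ht
  exact congrArg (fun L => L (X, 0)) (hasFDerivAt_chartRep (hf (x, t) ⟨trivial, ht⟩)).fderiv.symm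

/-- A function on a connected manifold is constant if its differential vanishes. -/
theorem eq_of_vdiff_eq_zero [IsManifold (𝓡 m) ∞ M₀] [ConnectedSpace M₀] {f : M₀ × ℝ → F} {s : ℝ}
    (hf : ∀ x, ContMDiffAt ((𝓡 m).prod 𝓘(ℝ, ℝ)) 𝓘(ℝ, F) ∞ f (x, s))
    (h0 : ∀ x X, vdiff (m := m) f (x, s) (X, 0) = 0) (x x' : M₀) : f (x, s) = f (x', s) := by
  have hloc : IsLocallyConstant fun x => f (x, s) := by
    rw [IsLocallyConstant.iff_eventually_eq]
    intro x
    set e := extChartAt (𝓡 m) x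
    have hopen : IsOpen e.target := isOpen_extChartAt_target x
    obtain ⟨r, hr, hball⟩ := Metric.isOpen_iff.1 hopen (e x) (mem_extChartAt_target x)
    have hder : ∀ y ∈ e.target, HasFDerivAt (fun y => f (e.symm y, s)) (0 : _ →L[ℝ] F) y := by
      intro y hy
      have hg : HasMFDerivAt (𝓡 m) ((𝓡 m).prod 𝓘(ℝ, ℝ)) (fun z : M₀ => (z, s)) (e.symm y)
          ((ContinuousLinearMap.id ℝ (EuclideanSpace ℝ (Fin m))).prod 0) :=
        (hasMFDerivAt_id _).prodMk (hasMFDerivAt_const s _)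
      have hes : MDifferentiableAt 𝓘(ℝ, EuclideanSpace ℝ (Fin m)) (𝓡 m) e.symm y := by
        have := mdifferentiableWithinAt_extChartAt_symm (I := 𝓡 m) hy
        rwa [ModelWithCorners.range_eq_univ, mdifferentiableWithinAt_univ] at this
      have hF := ((hf (e.symm y)).mdifferentiableAt (by simp)).hasMFDerivAt
      have hc := (hF.comp (e.symm y) hg).comp y hes.hasMFDerivAt
      have hc' := hc.hasFDerivAt
      refine hc'.congr_fderiv ?_
      refine ContinuousLinearMap.ext fun v => ?_
      -- Whatever the inverse chart makes of `v`, its image has no `∂_s` component.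
      exact h0 (e.symm y) _
    have hconst : ∀ y ∈ Metric.ball (e x) r, f (e.symm y, s) = f (e.symm (e x), s) := by
      intro y hy
      refine Convex.is_const_of_fderivWithin_eq_zero (𝕜 := ℝ) (f := fun y => f (e.symm y, s))
        (convex_ball (e x) r)
        (fun z hz => (hder z (hball hz)).differentiableAt.differentiableWithinAt) ?_ hy
        (Metric.mem_ball_self hr)
      intro z hz
      exact ((hder z (hball hz)).hasFDerivWithinAt).fderivWithin
        (Metric.isOpen_ball.uniqueDiffWithinAt hz)
    have hnhds : ∀ᶠ z in 𝓝 x, e z ∈ Metric.ball (e x) r :=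
      (continuousAt_extChartAt (I := 𝓡 m) x).eventually (Metric.ball_mem_nhds _ hr)
    filter_upwards [hnhds, extChartAt_source_mem_nhds (I := 𝓡 m) x] with z hz hz'
    have := hconst _ hz
    rwa [e.left_inv hz', e.left_inv (mem_extChartAt_source x)] at this
  exact hloc.apply_eq_of_preconnectedSpace x x'

end Calculus

/-! ### Linear algebra in codimension two -/

/-- The orthogonal complement of an injective image of `ℝ^m` in `ℝ^{m+2}` is spanned by any two
orthonormal vectors in it. -/
theorem eq_add_of_orthogonal_range {m : ℕ} (B : EuclideanSpace ℝ (Fin m) →ₗ[ℝ] Amb m)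
    (hB : Function.Injective B) {n T w : Amb m} (hn : ‖n‖ = 1) (hT : ‖T‖ = 1)
    (hnT : inner ℝ n T = 0) (hBn : ∀ X, inner ℝ (B X) n = 0) (hBT : ∀ X, inner ℝ (B X) T = 0)
    (hBw : ∀ X, inner ℝ (B X) w = 0) :
    w = inner ℝ w n • n + inner ℝ w T • T := by
  have hnn : inner ℝ n n = 1 := by rw [real_inner_self_eq_norm_sq, hn]; norm_num
  have hTT : inner ℝ T T = 1 := by rw [real_inner_self_eq_norm_sq, hT]; norm_num
  have hTn : inner ℝ T n = 0 := by rw [real_inner_comm, hnT]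
  -- `C` adjoins `n` and `T` to `B`. It is injective between spaces of dimension `m + 2`, hence
  -- onto, so the difference of the two sides is in its range; being orthogonal to that range, it
  -- vanishes.
  let C : EuclideanSpace ℝ (Fin m) × ℝ × ℝ →ₗ[ℝ] Amb m :=
    B.coprod ((LinearMap.toSpanSingleton ℝ _ n).coprod (LinearMap.toSpanSingleton ℝ _ T))
  have hC : ∀ X a b, C (X, a, b) = B X + (a • n + b • T) := fun X a b => rfl
  have hinj : Function.Injective C := by
    rw [← LinearMap.ker_eq_bot, LinearMap.ker_eq_bot']
    rintro ⟨X, a, b⟩ h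
    rw [hC] at h
    have ha := congrArg (fun z => inner ℝ z n) h
    have hb := congrArg (fun z => inner ℝ z T) h
    simp only [inner_add_left, inner_smul_left, hBn, hBT, hnn, hTT, hTn, hnT, inner_zero_left] at ha hb
    simp at ha hb
    subst ha hb
    simp only [zero_smul, add_zero] at h
    rw [hB (h.trans B.map_zero.symm)]
    rfl
  have hsurj : Function.Surjective C := by
    refine (LinearMap.injective_iff_surjective_of_finrank_eq_finrank ?_).1 hinj
    simp
  obtain ⟨⟨X, a, b⟩, h⟩ := hsurj (w - (inner ℝ w n • n + inner ℝ w T • T))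
  rw [← sub_eq_zero, ← inner_self_eq_zero (𝕜 := ℝ)]
  nth_rewrite 1 [← h]
  rw [hC]
  simp only [inner_add_left, inner_add_right, inner_sub_right, inner_smul_left, inner_smul_right,
    hBn, hBT, hBw, hnn, hTT, hTn, hnT, real_inner_comm w n, real_inner_comm w T]
  simp only [real_inner_comm n w, real_inner_comm T w]
  ring

/-! ### Smooth choice of centres -/

section Centres

variable {A : Type*} [NormedAddCommGroup A] [InnerProductSpace ℝ A]

/-- The vector of the span of `v` with prescribed inner products with `v` depends smoothly on the
independent family `v`. -/
theorem contDiffAt_of_inner_eq {d : ℕ} {v : Fin d → ℝ → A} {b : Fin d → ℝ → ℝ} {w : ℝ → A} {s : ℝ}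
    (hv : ∀ i, ContDiffAt ℝ ∞ (v i) s) (hb : ∀ i, ContDiffAt ℝ ∞ (b i) s)
    (hli : LinearIndependent ℝ fun i => v i s)
    (hw : ∀ᶠ t in 𝓝 s, LinearIndependent ℝ (fun i => v i t) ∧
      w t ∈ Submodule.span ℝ (Set.range fun i => v i t) ∧ ∀ i, inner ℝ (v i t) (w t) = b i t) :
    ContDiffAt ℝ ∞ w s := by
  let L : ℝ → (Fin d → ℝ) →L[ℝ] A := fun t =>
    (Fintype.linearCombination ℝ fun i => v i t).toContinuousLinearMap
  -- `G t` is the Gram matrix of the family, so that `w t = L t ((G t)⁻¹ (b t))`.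
  let G : ℝ → (Fin d → ℝ) →L[ℝ] (Fin d → ℝ) := fun t =>
    ∑ i, ∑ j, inner ℝ (v i t) (v j t) •
      (ContinuousLinearMap.proj j : (Fin d → ℝ) →L[ℝ] ℝ).smulRight (Pi.single i (1 : ℝ))
  have hLapp : ∀ t y, L t y = ∑ i, y i • v i t := fun t y => by
    simp [L, Fintype.linearCombination_apply]
  have hGapp : ∀ t y i, G t y i = inner ℝ (v i t) (L t y) := fun t y i => by
    simp [G, hLapp, Pi.single_apply, inner_sum, inner_smul_right, mul_comm]
  have hL : ∀ {y : ℝ → Fin d → ℝ}, ContDiffAt ℝ ∞ y s → ContDiffAt ℝ ∞ (fun t => L t (y t)) s := by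
    intro y hy
    simp only [hLapp]
    exact ContDiffAt.sum fun i _ => (contDiffAt_pi.1 hy i).smul (hv i)
  have hG : ContDiffAt ℝ ∞ G s := by
    exact ContDiffAt.sum fun i _ => ContDiffAt.sum fun j _ =>
      ((hv i).inner ℝ (hv j)).smul contDiffAt_const
  have hinj : ∀ t, LinearIndependent ℝ (fun i => v i t) → Function.Injective (G t) := by
    intro t ht
    rw [injective_iff_map_eq_zero]
    intro y hy
    have h1 : ∀ i, inner ℝ (v i t) (L t y) = 0 := fun i => by rw [← hGapp, hy]; rfl
    have h2 : L t y = 0 := by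
      rw [← inner_self_eq_zero (𝕜 := ℝ)]
      nth_rewrite 1 [hLapp]
      simp [sum_inner, inner_smul_left, h1]
    rw [hLapp] at h2
    exact funext (Fintype.linearIndependent_iff.1 ht y h2)
  have hequiv : ∀ t, LinearIndependent ℝ (fun i => v i t) →
      ∃ e : (Fin d → ℝ) ≃L[ℝ] (Fin d → ℝ), (e : (Fin d → ℝ) →L[ℝ] (Fin d → ℝ)) = G t := fun t ht =>
    ⟨(LinearEquiv.ofInjectiveEndo (G t : (Fin d → ℝ) →ₗ[ℝ] (Fin d → ℝ))
      (hinj t ht)).toContinuousLinearEquiv, by ext; rfl⟩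
  obtain ⟨e, he⟩ := hequiv s hli
  have hGinv : ContDiffAt ℝ ∞ (fun t => (G t).inverse) s :=
    by
    refine ContDiffAt.comp s (g := ContinuousLinearMap.inverse) ?_ hG
    rw [← he]
    exact contDiffAt_map_inverse e
  have hbs : ContDiffAt ℝ ∞ (fun t i => b i t) s := contDiffAt_pi.2 hb
  refine (hL (hGinv.clm_apply hbs)).congr_of_eventuallyEq ?_
  filter_upwards [hw] with t ht
  obtain ⟨hlit, hmem, hin⟩ := ht
  obtain ⟨e, he⟩ := hequiv t hlit
  rw [← Fintype.range_linearCombination] at hmem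
  obtain ⟨y, hy⟩ := hmem
  have hy' : L t y = w t := hy
  have : G t y = fun i => b i t := funext fun i => by rw [hGapp, hy', hin]
  rw [← this, ← hy', ← he]
  simp

/-- A basis of the span at `s` can be picked from the family, and independence is an open condition.
Hence the dimension of the span is lower semicontinuous. -/
theorem exists_eventually_linearIndependent [FiniteDimensional ℝ A] {X : Type*} {g : X → ℝ → A} {s : ℝ}
    (hg : ∀ x, ContinuousAt (g x) s) :
    ∃ x : Fin (Module.finrank ℝ (Submodule.span ℝ (Set.range fun x => g x s))) → X,
      ∀ᶠ t in 𝓝 s, LinearIndependent ℝ fun i => g (x i) t := by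
  obtain ⟨h, hmem, -, hli⟩ :=
    Submodule.exists_fun_fin_finrank_span_eq ℝ (Set.range fun x => g x s)
  choose x hx using hmem
  refine ⟨x, ?_⟩
  have hc : ContinuousAt (fun t i => g (x i) t) s := continuousAt_pi.2 fun i => hg (x i)
  refine hc.eventually (isOpen_setOfPred_linearIndependent.mem_nhds ?_)
  have : (fun i => g (x i) s) = h := funext hx
  simpa [this] using hli

/-- Points that lie, for each parameter, on a common sphere admit a smooth choice of centre over an
open dense set of parameters, which contains those at which they affinely span the space. -/
theorem exists_smooth_centre [FiniteDimensional ℝ A] {X : Type*} [Nonempty X] {g : X → ℝ → A} {I : Set ℝ} (hI : IsOpen I)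
    (hg : ∀ x, ∀ s ∈ I, ContDiffAt ℝ ∞ (g x) s)
    (hc : ∀ s ∈ I, ∃ (c : A) (R : ℝ), ∀ x, ‖g x s - c‖ = R) :
    ∃ J : Set ℝ, IsOpen J ∧ J ⊆ I ∧ I ⊆ closure J ∧
      (∀ s ∈ I, (¬ ∃ (u : A) (c : ℝ), u ≠ 0 ∧ ∀ x, inner ℝ u (g x s) = c) → s ∈ J) ∧
      ∃ γ : ℝ → A, ContDiffOn ℝ ∞ γ J ∧ ∀ s ∈ J, ∃ R, ∀ x, ‖g x s - γ s‖ = R := by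
  obtain ⟨x₀⟩ := ‹Nonempty X›
  let v : X → ℝ → A := fun x s => g x s - g x₀ s
  let V : ℝ → Submodule ℝ A := fun s => Submodule.span ℝ (Set.range fun x => v x s)
  let D : ℝ → ℕ := fun s => Module.finrank ℝ (V s)
  have hv : ∀ x, ∀ s ∈ I, ContDiffAt ℝ ∞ (v x) s := fun x s hs => (hg x s hs).sub (hg x₀ s hs)
  have hvV : ∀ x s, v x s ∈ V s := fun x s => Submodule.subset_span ⟨x, rfl⟩
  have hind : ∀ s ∈ I, ∃ x : Fin (D s) → X,
      ∀ᶠ t in 𝓝 s, LinearIndependent ℝ fun i => v (x i) t := fun s hs =>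
    exists_eventually_linearIndependent fun x => (hv x s hs).continuousAt
  have hle : ∀ {d : ℕ} (x : Fin d → X) (t : ℝ),
      Submodule.span ℝ (Set.range fun i => v (x i) t) ≤ V t := fun x t =>
    Submodule.span_mono (by rintro _ ⟨i, rfl⟩; exact ⟨x i, rfl⟩)
  have hlsc : ∀ s ∈ I, ∀ᶠ t in 𝓝 s, D s ≤ D t := by
    intro s hs
    obtain ⟨x, hx⟩ := hind s hs
    filter_upwards [hx] with t ht
    have := Submodule.finrank_mono (hle x t)
    rwa [finrank_span_eq_card ht, Fintype.card_fin] at this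
  choose! c R hcR using hc
  -- The chosen centres `c s` may vary wildly, but only by vectors of `(V s)ᗮ`. Their projection is
  -- determined by the linear equations `hw`, which express equal distance to `g x s` and `g x₀ s`.
  let w : ℝ → A := fun s => (V s).starProjection (c s - g x₀ s)
  have hw : ∀ s ∈ I, ∀ x, inner ℝ (v x s) (w s) = ‖v x s‖ ^ 2 / 2 := by
    intro s hs x
    have h1 : inner ℝ (v x s) (w s) = inner ℝ (v x s) (c s - g x₀ s) := by
      have := Submodule.starProjection_inner_eq_zero (K := V s) (c s - g x₀ s) (v x s) (hvV x s)
      rw [inner_sub_left, sub_eq_zero, real_inner_comm, real_inner_comm (v x s)] at this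
      exact this.symm
    have h2 : ‖v x s - (c s - g x₀ s)‖ = ‖c s - g x₀ s‖ := by
      rw [norm_sub_rev (c s), hcR s hs, ← hcR s hs x]
      congr 1
      simp [v]
    have h3 := norm_sub_sq_real (v x s) (c s - g x₀ s)
    rw [h2] at h3
    rw [h1]
    linarith
  refine ⟨{s ∈ I | ∀ᶠ t in 𝓝 s, D t = D s}, ?_, fun s hs => hs.1, ?_, ?_,
    fun s => g x₀ s + w s, ?_, ?_⟩
  · rw [isOpen_iff_mem_nhds]
    rintro s ⟨hs, hs'⟩
    filter_upwards [hI.mem_nhds hs, hs', hs'.eventually_nhds] with t ht h1 h2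
    exact ⟨ht, h2.mono fun r hr => hr.trans h1.symm⟩
  · intro s hs
    rw [mem_closure_iff]
    intro o ho hso
    have hne : (D '' (o ∩ I)).Nonempty := ⟨_, s, ⟨hso, hs⟩, rfl⟩
    have hbdd : BddAbove (D '' (o ∩ I)) :=
      ⟨Module.finrank ℝ A, by rintro _ ⟨t, -, rfl⟩; exact Submodule.finrank_le _⟩
    -- At a maximum of `D` over `o ∩ I`, lower semicontinuity makes `D` locally constant.
    obtain ⟨t, ht, htD⟩ := Nat.sSup_mem hne hbdd
    refine ⟨t, ht.1, ht.2, ?_⟩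
    filter_upwards [hlsc t ht.2, (ho.inter hI).mem_nhds ht] with r hr hr'
    exact le_antisymm (htD ▸ le_csSup hbdd ⟨r, hr', rfl⟩) hr
  · intro s hs hspan
    refine ⟨hs, ?_⟩
    have htop : V s = ⊤ := by
      by_contra hne
      have : (V s)ᗮ ≠ ⊥ := fun h => hne ((Submodule.orthogonal_eq_bot_iff).1 h)
      obtain ⟨u, hu, hu0⟩ := Submodule.exists_mem_ne_zero_of_ne_bot this
      refine hspan ⟨u, inner ℝ u (g x₀ s), hu0, fun x => ?_⟩
      have := (Submodule.mem_orthogonal' _ _).1 hu _ (hvV x s)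
      rwa [inner_sub_right, sub_eq_zero] at this
    filter_upwards [hlsc s hs] with t ht
    refine le_antisymm ?_ ht
    have : D s = Module.finrank ℝ A := by
      change Module.finrank ℝ (V s) = _
      rw [htop, finrank_top]
    rw [this]
    exact Submodule.finrank_le _
  · rintro s ⟨hs, hs'⟩
    obtain ⟨x, hx⟩ := hind s hs
    refine ((hg x₀ s hs).add ?_).contDiffWithinAt
    refine contDiffAt_of_inner_eq (v := fun i => v (x i)) (b := fun i t => ‖v (x i) t‖ ^ 2 / 2)
      (fun i => hv _ s hs) (fun i => ((hv _ s hs).norm_sq ℝ).div_const 2) hx.self_of_nhds ?_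
    filter_upwards [hx, hs', hI.mem_nhds hs] with t h1 h2 ht
    refine ⟨h1, ?_, fun i => hw t ht _⟩
    -- As the dimension does not jump, the frame chosen at `s` still spans `V t`.
    rw [Submodule.eq_of_le_of_finrank_eq (hle x t)
      (by rw [finrank_span_eq_card h1, Fintype.card_fin]; exact h2.symm)]
    exact Submodule.starProjection_apply_mem _ _
  · rintro s ⟨hs, -⟩
    refine ⟨‖w s‖, fun x => ?_⟩
    have h3 := norm_sub_sq_real (v x s) (w s)
    rw [hw s hs x] at h3
    have h4 : ‖v x s - w s‖ ^ 2 = ‖w s‖ ^ 2 := by linarith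
    have h5 := (sq_eq_sq₀ (norm_nonneg _) (norm_nonneg _)).1 h4
    rw [← h5, sub_add_eq_sub_sub]

end Centres

/-! ### Orthonormal frames adapted to the net -/

section Frames

variable {m : ℕ} {M₀ : Type*} [TopologicalSpace M₀] [ChartedSpace (EuclideanSpace ℝ (Fin m)) M₀]
  {I : Set ℝ}

theorem isOpen_prodDomain (hI : IsOpen I) : IsOpen (prodDomain M₀ I) := isOpen_univ.prod hI

theorem SmoothOn.contMDiffAt {F : Type*} [NormedAddCommGroup F] [NormedSpace ℝ F]
    {f : M₀ × ℝ → F} (hI : IsOpen I) (hf : SmoothOn (m := m) f (prodDomain M₀ I))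
    {p : M₀ × ℝ} (hp : p ∈ prodDomain M₀ I) :
    ContMDiffAt ((𝓡 m).prod 𝓘(ℝ, ℝ)) 𝓘(ℝ, F) ∞ f p :=
  ContMDiffOn.contMDiffAt hf ((isOpen_prodDomain hI).mem_nhds hp)

theorem contMDiffAt_comp_snd {F : Type*} [NormedAddCommGroup F] [NormedSpace ℝ F]
    {c : ℝ → F} (hI : IsOpen I) (hc : ContDiffOn ℝ ∞ c I)
    {p : M₀ × ℝ} (hp : p ∈ prodDomain M₀ I) :
    ContMDiffAt ((𝓡 m).prod 𝓘(ℝ, ℝ)) 𝓘(ℝ, F) ∞ (fun q : M₀ × ℝ => c q.2) p :=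
  (hc.contDiffAt (hI.mem_nhds hp.2)).contMDiffAt.comp p contMDiffAt_snd

/-- Product rule for the inner product in the direction of the leaves. -/
theorem inner_vdiff_add {f g : M₀ × ℝ → Amb m} {p : M₀ × ℝ} {c : ℝ}
    (hf : ContMDiffAt ((𝓡 m).prod 𝓘(ℝ, ℝ)) 𝓘(ℝ, Amb m) ∞ f p)
    (hg : ContMDiffAt ((𝓡 m).prod 𝓘(ℝ, ℝ)) 𝓘(ℝ, Amb m) ∞ g p)
    (h : ∀ x, inner ℝ (f (x, p.2)) (g (x, p.2)) = c) (X : EuclideanSpace ℝ (Fin m)) :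
    inner ℝ (f p) (vdiff (m := m) g p (X, 0)) + inner ℝ (vdiff (m := m) f p (X, 0)) (g p) = 0 := by
  obtain ⟨x, s⟩ := p
  have h1 := (hasDerivAt_chartLine hf X).inner ℝ (hasDerivAt_chartLine hg X)
  simp only [h, chartLine_zero] at h1
  exact h1.unique (hasDerivAt_const _ _)

/-- Product rule for the inner product in the direction of the factor `ℝ`. -/
theorem inner_sDeriv_add {f g : M₀ × ℝ → Amb m} {p : M₀ × ℝ} {c : ℝ} (hI : IsOpen I)
    (hp : p ∈ prodDomain M₀ I)
    (hf : ContMDiffAt ((𝓡 m).prod 𝓘(ℝ, ℝ)) 𝓘(ℝ, Amb m) ∞ f p)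
    (hg : ContMDiffAt ((𝓡 m).prod 𝓘(ℝ, ℝ)) 𝓘(ℝ, Amb m) ∞ g p)
    (h : ∀ q ∈ prodDomain M₀ I, inner ℝ (f q) (g q) = c) :
    inner ℝ (f p) (sDeriv g p) + inner ℝ (sDeriv f p) (g p) = 0 := by
  obtain ⟨x, s⟩ := p
  have h1 := (hasDerivAt_snd hf).inner ℝ (hasDerivAt_snd hg)
  rw [vdiff_zero_one hf, vdiff_zero_one hg] at h1
  refine h1.unique ((hasDerivAt_const s c).congr_of_eventuallyEq ?_)
  filter_upwards [hI.mem_nhds hp.2] with t ht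
  exact h (x, t) ⟨trivial, ht⟩

/-- Symmetry of the second fundamental form, for mixed arguments. -/
theorem inner_sDeriv_vdiff_comm {f ν : M₀ × ℝ → Amb m} (hI : IsOpen I)
    (hf : ∀ p ∈ prodDomain M₀ I, ContMDiffAt ((𝓡 m).prod 𝓘(ℝ, ℝ)) 𝓘(ℝ, Amb m) ∞ f p)
    (hν : ∀ p ∈ prodDomain M₀ I, ContMDiffAt ((𝓡 m).prod 𝓘(ℝ, ℝ)) 𝓘(ℝ, Amb m) ∞ ν p)
    (h0 : ∀ p ∈ prodDomain M₀ I, ∀ X, inner ℝ (vdiff (m := m) f p (X, 0)) (ν p) = 0)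
    (h1 : ∀ p ∈ prodDomain M₀ I, inner ℝ (sDeriv f p) (ν p) = 0)
    {p : M₀ × ℝ} (hp : p ∈ prodDomain M₀ I) (X : EuclideanSpace ℝ (Fin m)) :
    inner ℝ (vdiff (m := m) f p (X, 0)) (sDeriv ν p) = inner ℝ (sDeriv f p) (vdiff ν p (X, 0)) := by
  -- Differentiate `⟨∂_s f, ν⟩ = 0` along `X` and `⟨f_* X, ν⟩ = 0` along `∂_s`; the mixed second
  -- derivatives of `f` cancel.
  have e1 := inner_vdiff_add (contMDiffAt_sDeriv (hf p hp)) (hν p hp)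
    (fun x => h1 (x, p.2) ⟨trivial, hp.2⟩) X
  obtain ⟨x, s⟩ := p
  have e2 := (hasDerivAt_vdiff_snd hI hf (x := x) hp.2 X).inner ℝ (hasDerivAt_snd (hν _ hp))
  rw [vdiff_zero_one (hν _ hp)] at e2
  have e3 := e2.unique ((hasDerivAt_const s (0 : ℝ)).congr_of_eventuallyEq (by
    filter_upwards [hI.mem_nhds hp.2] with t ht
    exact h0 (x, t) ⟨trivial, ht⟩ X))
  linarith

/-- `T` is a unit tangent field along the immersed hypersurface `n` of the sphere, orthogonal to
the leaves of the product net, with `∂_s n = ρ T`. -/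
structure IsNetFrame (I : Set ℝ) (n T : M₀ × ℝ → Amb m) (ρ : M₀ × ℝ → ℝ) : Prop where
  smooth_n : ∀ p ∈ prodDomain M₀ I, ContMDiffAt ((𝓡 m).prod 𝓘(ℝ, ℝ)) 𝓘(ℝ, Amb m) ∞ n p
  smooth_T : ∀ p ∈ prodDomain M₀ I, ContMDiffAt ((𝓡 m).prod 𝓘(ℝ, ℝ)) 𝓘(ℝ, Amb m) ∞ T p
  norm_n : ∀ p ∈ prodDomain M₀ I, ‖n p‖ = 1
  norm_T : ∀ p ∈ prodDomain M₀ I, ‖T p‖ = 1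
  inner_nT : ∀ p ∈ prodDomain M₀ I, inner ℝ (n p) (T p) = 0
  inner_vdiff_T : ∀ p ∈ prodDomain M₀ I, ∀ X, inner ℝ (vdiff (m := m) n p (X, 0)) (T p) = 0
  sDeriv_n : ∀ p ∈ prodDomain M₀ I, sDeriv n p = ρ p • T p
  injective : ∀ p ∈ prodDomain M₀ I, Function.Injective (vdiff (m := m) n p)

namespace IsNetFrame

variable {n T : M₀ × ℝ → Amb m} {ρ : M₀ × ℝ → ℝ}

theorem mono (h : IsNetFrame I n T ρ) {J : Set ℝ} (hJ : J ⊆ I) : IsNetFrame J n T ρ where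
  smooth_n p hp := h.smooth_n p ⟨trivial, hJ hp.2⟩
  smooth_T p hp := h.smooth_T p ⟨trivial, hJ hp.2⟩
  norm_n p hp := h.norm_n p ⟨trivial, hJ hp.2⟩
  norm_T p hp := h.norm_T p ⟨trivial, hJ hp.2⟩
  inner_nT p hp := h.inner_nT p ⟨trivial, hJ hp.2⟩
  inner_vdiff_T p hp := h.inner_vdiff_T p ⟨trivial, hJ hp.2⟩
  sDeriv_n p hp := h.sDeriv_n p ⟨trivial, hJ hp.2⟩
  injective p hp := h.injective p ⟨trivial, hJ hp.2⟩

variable {p : M₀ × ℝ}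

theorem inner_nn (h : IsNetFrame I n T ρ) (hp : p ∈ prodDomain M₀ I) :
    inner ℝ (n p) (n p) = 1 := by
  rw [real_inner_self_eq_norm_sq, h.norm_n p hp, one_pow]

theorem inner_TT (h : IsNetFrame I n T ρ) (hp : p ∈ prodDomain M₀ I) :
    inner ℝ (T p) (T p) = 1 := by
  rw [real_inner_self_eq_norm_sq, h.norm_T p hp, one_pow]

theorem inner_Tn (h : IsNetFrame I n T ρ) (hp : p ∈ prodDomain M₀ I) :
    inner ℝ (T p) (n p) = 0 := by
  rw [real_inner_comm, h.inner_nT p hp]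

theorem inner_vdiff_n (h : IsNetFrame I n T ρ) (hp : p ∈ prodDomain M₀ I)
    (X : EuclideanSpace ℝ (Fin m)) : inner ℝ (vdiff (m := m) n p (X, 0)) (n p) = 0 := by
  have := inner_vdiff_add (h.smooth_n p hp) (h.smooth_n p hp)
    (fun x => h.inner_nn (p := (x, p.2)) ⟨trivial, hp.2⟩) X
  rw [real_inner_comm] at this
  linarith

theorem inner_vdiffT_T (h : IsNetFrame I n T ρ) (hp : p ∈ prodDomain M₀ I)
    (X : EuclideanSpace ℝ (Fin m)) : inner ℝ (vdiff (m := m) T p (X, 0)) (T p) = 0 := by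
  have := inner_vdiff_add (h.smooth_T p hp) (h.smooth_T p hp)
    (fun x => h.inner_TT (p := (x, p.2)) ⟨trivial, hp.2⟩) X
  rw [real_inner_comm] at this
  linarith

theorem inner_vdiffT_n (h : IsNetFrame I n T ρ) (hp : p ∈ prodDomain M₀ I)
    (X : EuclideanSpace ℝ (Fin m)) : inner ℝ (vdiff (m := m) T p (X, 0)) (n p) = 0 := by
  have := inner_vdiff_add (h.smooth_n p hp) (h.smooth_T p hp)
    (fun x => h.inner_nT (x, p.2) ⟨trivial, hp.2⟩) X
  rw [h.inner_vdiff_T p hp, add_zero, real_inner_comm] at this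
  exact this

theorem inner_sDerivT_n (h : IsNetFrame I n T ρ) (hI : IsOpen I) (hp : p ∈ prodDomain M₀ I) :
    inner ℝ (sDeriv T p) (n p) = -ρ p := by
  have := inner_sDeriv_add hI hp (h.smooth_n p hp) (h.smooth_T p hp) h.inner_nT
  rw [h.sDeriv_n p hp, inner_smul_left, h.inner_TT hp, real_inner_comm] at this
  simp at this
  linarith

/-- A vector orthogonal to the tangent space of a leaf of an immersion adapted to the frame. -/
theorem eq_add (h : IsNetFrame I n T ρ) (hp : p ∈ prodDomain M₀ I) {f : M₀ × ℝ → Amb m}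
    (hf : Function.Injective (vdiff (m := m) f p))
    (hfn : ∀ X, inner ℝ (vdiff (m := m) f p (X, 0)) (n p) = 0)
    (hfT : ∀ X, inner ℝ (vdiff (m := m) f p (X, 0)) (T p) = 0) {w : Amb m}
    (hw : ∀ X, inner ℝ (vdiff (m := m) f p (X, 0)) w = 0) :
    w = inner ℝ w (n p) • n p + inner ℝ w (T p) • T p :=
  eq_add_of_orthogonal_range
    ((vdiff (m := m) f p : TVec m →ₗ[ℝ] Amb m) ∘ₗ LinearMap.inl ℝ _ _)
    (hf.comp LinearMap.inl_injective) (h.norm_n p hp) (h.norm_T p hp) (h.inner_nT p hp) hfn hfT hw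

variable {γ : ℝ → Amb m} {α β : ℝ → ℝ} {f : M₀ × ℝ → Amb m}

theorem contMDiffAt_combination (h : IsNetFrame I n T ρ) (hI : IsOpen I)
    (hγ : ContDiffOn ℝ ∞ γ I) (hα : ContDiffOn ℝ ∞ α I) (hβ : ContDiffOn ℝ ∞ β I)
    (hf : ∀ p ∈ prodDomain M₀ I, f p = γ p.2 + α p.2 • n p + β p.2 • T p)
    (hp : p ∈ prodDomain M₀ I) :
    ContMDiffAt ((𝓡 m).prod 𝓘(ℝ, ℝ)) 𝓘(ℝ, Amb m) ∞ f p := by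
  have h1 := ((contMDiffAt_comp_snd (m := m) (M₀ := M₀) hI hγ hp).add
    ((contMDiffAt_comp_snd (m := m) hI hα hp).smul (h.smooth_n p hp))).add
    ((contMDiffAt_comp_snd (m := m) hI hβ hp).smul (h.smooth_T p hp))
  refine h1.congr_of_eventuallyEq ?_
  filter_upwards [(isOpen_prodDomain hI).mem_nhds hp] with q hq
  exact hf q hq

theorem vdiff_combination (h : IsNetFrame I n T ρ)
    (hf : ∀ p ∈ prodDomain M₀ I, f p = γ p.2 + α p.2 • n p + β p.2 • T p)
    (hp : p ∈ prodDomain M₀ I)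
    (hfs : ContMDiffAt ((𝓡 m).prod 𝓘(ℝ, ℝ)) 𝓘(ℝ, Amb m) ∞ f p) (X : EuclideanSpace ℝ (Fin m)) :
    vdiff (m := m) f p (X, 0) = α p.2 • vdiff (m := m) n p (X, 0) + β p.2 • vdiff (m := m) T p (X, 0) := by
  obtain ⟨x, s⟩ := p
  have h1 := (((hasDerivAt_chartLine (h.smooth_n _ hp) X).const_smul (α s)).const_add (γ s)).add
    ((hasDerivAt_chartLine (h.smooth_T _ hp) X).const_smul (β s))
  refine (hasDerivAt_chartLine hfs X).unique (h1.congr_of_eventuallyEq ?_)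
  exact Filter.Eventually.of_forall fun t => hf (chartLine x X t, s) ⟨trivial, hp.2⟩

/-- Since `⟨∂_s n, n⟩ = 0` and `⟨∂_s T, n⟩ = -ρ`, equation (1) is the vanishing of the normal
component of `∂_s f`. Both directions of the theorem use this. -/
theorem inner_sDeriv_combination (h : IsNetFrame I n T ρ) (hI : IsOpen I)
    (hγ : ContDiffOn ℝ ∞ γ I) (hα : ContDiffOn ℝ ∞ α I) (hβ : ContDiffOn ℝ ∞ β I)
    (hf : ∀ p ∈ prodDomain M₀ I, f p = γ p.2 + α p.2 • n p + β p.2 • T p)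
    (hp : p ∈ prodDomain M₀ I) :
    inner ℝ (sDeriv f p) (n p) =
      inner ℝ (deriv γ p.2) (n p) + deriv α p.2 - β p.2 * ρ p := by
  obtain ⟨x, s⟩ := p
  have hd : ∀ {F : Type} [NormedAddCommGroup F] [NormedSpace ℝ F] {c : ℝ → F},
      ContDiffOn ℝ ∞ c I → HasDerivAt c (deriv c s) s := fun hc =>
    ((hc.contDiffAt (hI.mem_nhds hp.2)).differentiableAt (by simp)).hasDerivAt
  have hn := hasDerivAt_snd (h.smooth_n _ hp)
  have hT := hasDerivAt_snd (h.smooth_T _ hp)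
  rw [vdiff_zero_one (h.smooth_n _ hp)] at hn
  rw [vdiff_zero_one (h.smooth_T _ hp)] at hT
  have h1 := ((hd hγ).add ((hd hα).smul hn)).add ((hd hβ).smul hT)
  have h2 : HasDerivAt (fun t => f (x, t)) _ s := h1.congr_of_eventuallyEq (by
    filter_upwards [hI.mem_nhds hp.2] with t ht
    exact hf (x, t) ⟨trivial, ht⟩)
  have h3 : sDeriv f (x, s) = _ := h2.deriv
  rw [h3]
  simp only [inner_add_left, inner_smul_left, h.sDeriv_n _ hp, h.inner_sDerivT_n hI hp,
    h.inner_nn hp, h.inner_Tn hp]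
  simp
  ring

end IsNetFrame

end Frames

/-! ### Hypersurfaces of Enneper type and their Gauss maps -/

section Main

variable {m : ℕ} {M₀ : Type*} [TopologicalSpace M₀] [ChartedSpace (EuclideanSpace ℝ (Fin m)) M₀]
  {I : Set ℝ} {N : M₀ × ℝ → USphere m} {ρ : M₀ × ℝ → ℝ}

theorem contMDiff_coe_uSphere (m : ℕ) :
    ContMDiff (𝓡 (m + 1)) 𝓘(ℝ, Amb m) ∞ ((↑) : USphere m → Amb m) :=
  have := Fact.mk (finrank_euclideanSpace_fin (𝕜 := ℝ) (n := m + 1 + 1))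
  contMDiff_coe_sphere

theorem injective_mfderiv_coe_uSphere {m : ℕ} (v : USphere m) :
    Function.Injective (mfderiv (𝓡 (m + 1)) 𝓘(ℝ, Amb m) ((↑) : USphere m → Amb m) v) := by
  have := Fact.mk (finrank_euclideanSpace_fin (𝕜 := ℝ) (n := m + 1 + 1))
  exact injective_mvfderiv_subtypeVal_sphere (n := m + 1) v

theorem norm_toAmb {X : Type*} (N : X × ℝ → USphere m) (p : X × ℝ) : ‖toAmb N p‖ = 1 :=
  norm_eq_of_mem_sphere (N p)

theorem contMDiffAt_toAmb
    (hN : IsLocalDiffeomorphOn ((𝓡 m).prod 𝓘(ℝ, ℝ)) (𝓡 (m + 1)) ∞ N (prodDomain M₀ I))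
    {p : M₀ × ℝ} (hp : p ∈ prodDomain M₀ I) :
    ContMDiffAt ((𝓡 m).prod 𝓘(ℝ, ℝ)) 𝓘(ℝ, Amb m) ∞ (toAmb N) p :=
  (contMDiff_coe_uSphere m).contMDiffAt.comp p (hN ⟨p, hp⟩).contMDiffAt

theorem injective_vdiff_toAmb
    (hN : IsLocalDiffeomorphOn ((𝓡 m).prod 𝓘(ℝ, ℝ)) (𝓡 (m + 1)) ∞ N (prodDomain M₀ I))
    {p : M₀ × ℝ} (hp : p ∈ prodDomain M₀ I) :
    Function.Injective (vdiff (m := m) (toAmb N) p) := by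
  have hNp := hN ⟨p, hp⟩
  have h1 : MDifferentiableAt (𝓡 (m + 1)) 𝓘(ℝ, Amb m) ((↑) : USphere m → Amb m) (N p) :=
    (contMDiff_coe_uSphere m).contMDiffAt.mdifferentiableAt (by simp)
  have h2 := mfderiv_comp p h1 (hNp.mdifferentiableAt (by simp))
  have h3 : Function.Injective (mfderiv ((𝓡 m).prod 𝓘(ℝ, ℝ)) (𝓡 (m + 1)) N p) :=
    (hNp.mfderivToContinuousLinearEquiv (by simp)).injective
  have h4 := (injective_mfderiv_coe_uSphere (N p)).comp h3
  intro v w hvw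
  apply h4
  have h5 : vdiff (m := m) (toAmb N) p = _ := h2
  rw [h5] at hvw
  exact hvw

theorem sDeriv_toAmb_ne_zero
    (hN : IsLocalDiffeomorphOn ((𝓡 m).prod 𝓘(ℝ, ℝ)) (𝓡 (m + 1)) ∞ N (prodDomain M₀ I))
    {p : M₀ × ℝ} (hp : p ∈ prodDomain M₀ I) : sDeriv (toAmb N) p ≠ 0 := by
  intro h
  rw [← vdiff_zero_one (contMDiffAt_toAmb hN hp)] at h
  have := injective_vdiff_toAmb hN hp (h.trans (map_zero _).symm)
  simpa using congrArg Prod.snd this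

theorem MetricSplitsOn.sq_eq (hρ : MetricSplitsOn N ρ (prodDomain M₀ I))
    (hN : IsLocalDiffeomorphOn ((𝓡 m).prod 𝓘(ℝ, ℝ)) (𝓡 (m + 1)) ∞ N (prodDomain M₀ I))
    {p : M₀ × ℝ} (hp : p ∈ prodDomain M₀ I) : ρ p ^ 2 = ‖sDeriv (toAmb N) p‖ ^ 2 := by
  have h : inner ℝ (vdiff (m := m) (toAmb N) p (0, 1)) (vdiff (m := m) (toAmb N) p (0, 1)) =
      inner ℝ (vdiff (m := m) (toAmb N) p (0, 0)) (vdiff (m := m) (toAmb N) p (0, 0)) +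
        ρ p ^ 2 * (1 * 1) := hρ.2 p hp 0 0 1 1
  rw [vdiff_zero_one (contMDiffAt_toAmb hN hp), real_inner_self_eq_norm_sq,
    show ((0, 0) : TVec m) = 0 from rfl, map_zero, inner_zero_left] at h
  linarith

theorem MetricSplitsOn.netOrthogonalOn {U : Set (M₀ × ℝ)} (hρ : MetricSplitsOn N ρ U) :
    NetOrthogonalOn (m := m) (toAmb N) U := by
  intro p hp X r
  have h := hρ.2 p hp X 0 0 r
  rw [h, inducedMetric, show ((0, 0) : TVec m) = 0 from rfl, map_zero, inner_zero_right]
  ring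

/-- Only `ρ² = |∂_s N|²` is known, not the sign of `ρ`; since `∂_s N ≠ 0`, the field `ρ⁻¹ ∂_s N` is
a smooth unit field for either sign. -/
theorem MetricSplitsOn.isNetFrame (hI : IsOpen I) (hρ : MetricSplitsOn N ρ (prodDomain M₀ I))
    (hN : IsLocalDiffeomorphOn ((𝓡 m).prod 𝓘(ℝ, ℝ)) (𝓡 (m + 1)) ∞ N (prodDomain M₀ I)) :
    (∀ p ∈ prodDomain M₀ I, ρ p ≠ 0) ∧
    IsNetFrame I (toAmb N) (fun p => (ρ p)⁻¹ • sDeriv (toAmb N) p) ρ := by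
  have hsq := fun p hp => hρ.sq_eq hN (p := p) hp
  have hne : ∀ p ∈ prodDomain M₀ I, ρ p ≠ 0 := by
    intro p hp h
    have h2 := hsq p hp
    rw [h] at h2
    exact sDeriv_toAmb_ne_zero hN hp (by simpa using h2.symm)
  have hsm := fun p hp => contMDiffAt_toAmb hN (p := p) hp
  refine ⟨hne, hsm, fun p hp => ?_, fun p _ => norm_toAmb N p, fun p hp => ?_, fun p hp => ?_,
    fun p hp X => ?_, fun p hp => ?_, fun p hp => injective_vdiff_toAmb hN hp⟩
  · exact ((hρ.1.contMDiffAt hI hp).inv₀ (hne p hp)).smul (contMDiffAt_sDeriv (hsm p hp))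
  · rw [norm_smul, norm_inv, Real.norm_eq_abs,
      (sq_eq_sq₀ (abs_nonneg _) (norm_nonneg _)).1 ((sq_abs _).trans (hsq p hp))]
    exact inv_mul_cancel₀ (norm_ne_zero_iff.2 (sDeriv_toAmb_ne_zero hN hp))
  · have := inner_sDeriv_add hI hp (hsm p hp) (hsm p hp) (c := 1) fun q _ => by
      rw [real_inner_self_eq_norm_sq, norm_toAmb, one_pow]
    rw [real_inner_comm (toAmb N p)] at this
    rw [inner_smul_right]
    have h0 : inner ℝ (toAmb N p) (sDeriv (toAmb N) p) = 0 := by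
      rw [real_inner_comm] at this
      rw [real_inner_comm]
      linarith
    rw [h0, mul_zero]
  · have h := hρ.netOrthogonalOn p hp X 1
    change inner ℝ (vdiff (m := m) (toAmb N) p (X, 0)) (vdiff (m := m) (toAmb N) p (0, 1)) = 0 at h
    rw [vdiff_zero_one (hsm p hp)] at h
    rw [inner_smul_right, h, mul_zero]
  · rw [smul_smul, mul_inv_cancel₀ (hne p hp), one_smul]

theorem exists_metricSplitsOn
    (hN : IsLocalDiffeomorphOn ((𝓡 m).prod 𝓘(ℝ, ℝ)) (𝓡 (m + 1)) ∞ N (prodDomain M₀ I))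
    (h : NetOrthogonalOn (m := m) (toAmb N) (prodDomain M₀ I)) :
    ∃ ρ, MetricSplitsOn N ρ (prodDomain M₀ I) := by
  refine ⟨fun p => ‖sDeriv (toAmb N) p‖, fun p hp => ?_, fun p hp X Y a b => ?_⟩
  · have h1 := contMDiffAt_sDeriv (contMDiffAt_toAmb hN hp)
    exact ((contDiffAt_norm ℝ (sDeriv_toAmb_ne_zero hN hp)).contMDiffAt.comp p
      h1).contMDiffWithinAt
  · have hsm := contMDiffAt_toAmb hN hp
    have h1 : ∀ X, inner ℝ (vdiff (m := m) (toAmb N) p (X, 0)) (sDeriv (toAmb N) p) = 0 := by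
      intro X
      rw [← vdiff_zero_one hsm]
      exact h p hp X 1
    change inner ℝ (vdiff (m := m) (toAmb N) p (X, a)) (vdiff (m := m) (toAmb N) p (Y, b)) =
      inner ℝ (vdiff (m := m) (toAmb N) p (X, 0)) (vdiff (m := m) (toAmb N) p (Y, 0)) + _
    rw [vdiff_mk hsm X a, vdiff_mk hsm Y b]
    simp only [inner_add_left, inner_add_right, inner_smul_left, inner_smul_right, h1,
      real_inner_comm _ (sDeriv (toAmb N) p), real_inner_self_eq_norm_sq]
    simp
    ring

theorem enneperMap_eq
    (hN : IsLocalDiffeomorphOn ((𝓡 m).prod 𝓘(ℝ, ℝ)) (𝓡 (m + 1)) ∞ N (prodDomain M₀ I))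
    (γ : ℝ → Amb m) (α β : ℝ → ℝ) {p : M₀ × ℝ} (hp : p ∈ prodDomain M₀ I) :
    enneperMap N ρ γ α β p =
      γ p.2 + α p.2 • toAmb N p + β p.2 • (ρ p)⁻¹ • sDeriv (toAmb N) p := by
  rw [← vdiff_zero_one (contMDiffAt_toAmb hN hp), smul_smul]
  rfl

theorem IsNetFrame.isEnneperOn (hm : 1 ≤ m) {n T f : M₀ × ℝ → Amb m} (h : IsNetFrame I n T ρ)
    (hI : IsOpen I) {γ : ℝ → Amb m} {α β : ℝ → ℝ}
    (hγ : ContDiffOn ℝ ∞ γ I) (hα : ContDiffOn ℝ ∞ α I) (hβ : ContDiffOn ℝ ∞ β I)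
    (heq : ∀ p ∈ prodDomain M₀ I, inner ℝ (deriv γ p.2) (n p) + deriv α p.2 = β p.2 * ρ p)
    (hf : ∀ p ∈ prodDomain M₀ I, f p = γ p.2 + α p.2 • n p + β p.2 • T p) :
    IsEnneperOn f n (regularPoints f (prodDomain M₀ I)) ∧
      LeavesInSpheresCentred f (regularPoints f (prodDomain M₀ I)) γ := by
  have hsm := fun p hp => h.contMDiffAt_combination hI hγ hα hβ hf (p := p) hp
  have hX := fun p hp X => h.vdiff_combination hf (p := p) hp (hsm p hp) X
  have hXn : ∀ p ∈ prodDomain M₀ I, ∀ X, inner ℝ (vdiff (m := m) f p (X, 0)) (n p) = 0 := by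
    intro p hp X
    rw [hX p hp, inner_add_left, inner_smul_left, inner_smul_left, h.inner_vdiff_n hp,
      h.inner_vdiffT_n hp, mul_zero, mul_zero, add_zero]
  have hXT : ∀ p ∈ prodDomain M₀ I, ∀ X, inner ℝ (vdiff (m := m) f p (X, 0)) (T p) = 0 := by
    intro p hp X
    rw [hX p hp, inner_add_left, inner_smul_left, inner_smul_left, h.inner_vdiff_T p hp,
      h.inner_vdiffT_T hp, mul_zero, mul_zero, add_zero]
  have hsn : ∀ p ∈ prodDomain M₀ I, inner ℝ (sDeriv f p) (n p) = 0 := by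
    intro p hp
    rw [h.inner_sDeriv_combination hI hγ hα hβ hf hp, heq p hp, sub_self]
  have hII : ∀ p ∈ prodDomain M₀ I, ∀ X,
      inner ℝ (vdiff (m := m) n p (X, 0)) (sDeriv f p) = 0 := by
    intro p hp X
    rw [real_inner_comm, ← inner_sDeriv_vdiff_comm hI hsm h.smooth_n hXn hsn hp, h.sDeriv_n p hp,
      inner_smul_right, hXT p hp, mul_zero]
  have hsT : ∀ p ∈ prodDomain M₀ I, sDeriv f p = inner ℝ (sDeriv f p) (T p) • T p := by
    intro p hp
    have := h.eq_add hp (h.injective p hp) (fun X => h.inner_vdiff_n hp X) (h.inner_vdiff_T p hp)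
      (hII p hp)
    rwa [hsn p hp, zero_smul, zero_add] at this
  have hs : ∀ p ∈ prodDomain M₀ I, ∀ r : ℝ, vdiff (m := m) f p (0, r) = r • sDeriv f p := by
    intro p hp r
    rw [vdiff_mk (hsm p hp), show ((0, 0) : TVec m) = 0 from rfl, map_zero, zero_add]
  have hleaves : LeavesInSpheresCentred f (regularPoints f (prodDomain M₀ I)) γ := by
    intro s
    -- If the radius degenerates, `f` is constant on the leaf; as `m ≥ 1`, it has no regular points
    -- there, and any radius will do.
    by_cases hab : α s ^ 2 + β s ^ 2 = 0
    · refine ⟨1, one_pos, fun x hx => ?_⟩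
      have hα0 : α s = 0 := by nlinarith [sq_nonneg (α s), sq_nonneg (β s)]
      have hβ0 : β s = 0 := by nlinarith [sq_nonneg (α s), sq_nonneg (β s)]
      let e : EuclideanSpace ℝ (Fin m) := EuclideanSpace.single ⟨0, hm⟩ 1
      have h0 : vdiff (m := m) f (x, s) (e, 0) = 0 := by
        rw [hX _ hx.1]
        simp [hα0, hβ0]
      have h1 := hx.2 (h0.trans (map_zero _).symm)
      have h2 : e = 0 := congrArg Prod.fst h1
      simp [e] at h2
    · refine ⟨√(α s ^ 2 + β s ^ 2), Real.sqrt_pos.2 (lt_of_le_of_ne (by positivity) (Ne.symm hab)),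
        fun x hx => ?_⟩
      rw [mem_sphere_iff_norm, hf _ hx.1, eq_comm, Real.sqrt_eq_iff_eq_sq (by positivity)
        (norm_nonneg _), ← real_inner_self_eq_norm_sq]
      simp only [add_assoc, add_sub_cancel_left]
      simp only [inner_add_left, inner_add_right, inner_smul_left, inner_smul_right,
        h.inner_nn hx.1, h.inner_TT hx.1, h.inner_nT _ hx.1, h.inner_Tn hx.1]
      simp
      ring
  refine ⟨⟨⟨fun p hp => (hsm p hp.1).contMDiffWithinAt, fun p hp => hp.2⟩,
    ⟨fun p hp => (h.smooth_n p hp.1).contMDiffWithinAt,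
      fun p hp => ⟨h.norm_n p hp.1, fun v => ?_⟩⟩, fun p hp X r => ?_, fun p hp X r => ?_,
    γ, hleaves⟩, hleaves⟩
  · change inner ℝ (vdiff (m := m) f p (v.1, v.2)) (n p) = 0
    rw [vdiff_mk (hsm p hp.1), inner_add_left, inner_smul_left, hXn p hp.1, hsn p hp.1, mul_zero,
      add_zero]
  · change inner ℝ (vdiff (m := m) f p (X, 0)) (vdiff (m := m) f p (0, r)) = 0
    rw [hs p hp.1, hsT p hp.1, inner_smul_right, inner_smul_right, hXT p hp.1, mul_zero, mul_zero]
  · change -inner ℝ (vdiff (m := m) n p (X, 0)) (vdiff (m := m) f p (0, r)) = 0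
    rw [hs p hp.1, inner_smul_right, hII p hp.1, mul_zero, neg_zero]

theorem IsEnneperOn.mono {f ν : M₀ × ℝ → Amb m} {U V : Set (M₀ × ℝ)} (h : IsEnneperOn f ν U)
    (hV : V ⊆ U) : IsEnneperOn f ν V where
  immersed := ⟨h.immersed.1.mono hV, fun p hp => h.immersed.2 p (hV hp)⟩
  gauss := ⟨h.gauss.1.mono hV, fun p hp => h.gauss.2 p (hV hp)⟩
  orthogonal p hp := h.orthogonal p (hV hp)
  adapted p hp := h.adapted p (hV hp)
  spherical := by
    obtain ⟨c, hc⟩ := h.spherical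
    refine ⟨c, fun s => ?_⟩
    obtain ⟨R, hR, hx⟩ := hc s
    exact ⟨R, hR, fun x hxs => hx x (hV hxs)⟩

/-- Adaptedness reads `⟨ν_* X, ∂_s f⟩ = 0`; symmetry of the second fundamental form exchanges the
roles of `f` and `ν`. -/
theorem IsEnneperOn.inner_vdiff_sDeriv_gauss {f ν : M₀ × ℝ → Amb m} (hI : IsOpen I)
    (h : IsEnneperOn f ν (prodDomain M₀ I)) {p : M₀ × ℝ} (hp : p ∈ prodDomain M₀ I)
    (X : EuclideanSpace ℝ (Fin m)) : inner ℝ (vdiff (m := m) f p (X, 0)) (sDeriv ν p) = 0 := by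
  have hf := fun p hp => h.immersed.1.contMDiffAt hI (p := p) hp
  have hν := fun p hp => h.gauss.1.contMDiffAt hI (p := p) hp
  rw [inner_sDeriv_vdiff_comm hI hf hν (fun p hp X => (h.gauss.2 p hp).2 (X, 0))
    (fun p hp => by rw [← vdiff_zero_one (hf p hp)]; exact (h.gauss.2 p hp).2 (0, 1)) hp,
    real_inner_comm, ← vdiff_zero_one (hf p hp)]
  exact neg_eq_zero.1 (h.adapted p hp X 1)

theorem IsEnneperOn.netOrthogonalOn_gauss {f ν : M₀ × ℝ → Amb m} (hI : IsOpen I)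
    (h : IsEnneperOn f ν (prodDomain M₀ I)) : NetOrthogonalOn ν (prodDomain M₀ I) := by
  intro p hp X r
  have hf := h.immersed.1.contMDiffAt hI hp
  have hν := h.gauss.1.contMDiffAt hI hp
  have hfs : inner ℝ (sDeriv f p) (ν p) = 0 := by
    rw [← vdiff_zero_one hf]; exact (h.gauss.2 p hp).2 (0, 1)
  have hne : ‖sDeriv f p‖ ≠ 0 := by
    rw [norm_ne_zero_iff, ← vdiff_zero_one hf]
    intro h0
    simpa using congrArg Prod.snd (h.immersed.2 p hp (h0.trans (map_zero _).symm))
  have hsν : inner ℝ (sDeriv ν p) (ν p) = 0 := by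
    have := inner_sDeriv_add hI hp hν hν (c := 1) fun q hq => by
      rw [real_inner_self_eq_norm_sq, (h.gauss.2 q hq).1, one_pow]
    rw [real_inner_comm] at this
    linarith
  have horth : ∀ X, inner ℝ (vdiff (m := m) f p (X, 0)) (sDeriv f p) = 0 := fun X => by
    rw [← vdiff_zero_one hf]; exact h.orthogonal p hp X 1
  -- The complement of `f_* E₀` is spanned by `ν` and `∂_s f`, so `∂_s ν`, orthogonal to `ν`, is a
  -- multiple of `∂_s f`.
  have key := eq_add_of_orthogonal_range
    ((vdiff (m := m) f p : TVec m →ₗ[ℝ] Amb m) ∘ₗ LinearMap.inl ℝ _ _)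
    ((h.immersed.2 p hp).comp LinearMap.inl_injective) (n := ν p)
    (T := ‖sDeriv f p‖⁻¹ • sDeriv f p) (w := sDeriv ν p) (h.gauss.2 p hp).1
    (by rw [norm_smul, norm_inv, norm_norm, inv_mul_cancel₀ hne])
    (by rw [inner_smul_right, real_inner_comm, hfs, mul_zero])
    (fun X => (h.gauss.2 p hp).2 (X, 0))
    (fun X => by
      rw [inner_smul_right]
      exact mul_eq_zero_of_right _ (horth X))
    (fun X => h.inner_vdiff_sDeriv_gauss hI hp X)
  rw [hsν, zero_smul, zero_add] at key
  have hadapt : inner ℝ (vdiff (m := m) ν p (X, 0)) (sDeriv f p) = 0 := by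
    rw [← vdiff_zero_one hf]; exact neg_eq_zero.1 (h.adapted p hp X 1)
  change inner ℝ (vdiff (m := m) ν p (X, 0)) (vdiff (m := m) ν p (0, r)) = 0
  rw [vdiff_mk hν 0 r, show ((0, 0) : TVec m) = 0 from rfl, map_zero, zero_add, key]
  simp only [inner_smul_right, hadapt, mul_zero]

theorem IsNetFrame.exists_triple [IsManifold (𝓡 m) ∞ M₀] [ConnectedSpace M₀]
    {n T f : M₀ × ℝ → Amb m} (h : IsNetFrame I n T ρ) (hI : IsOpen I)
    (hρ : ∀ p ∈ prodDomain M₀ I, ρ p ≠ 0) (hf : IsEnneperOn f n (prodDomain M₀ I))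
    {γ : ℝ → Amb m} (hγ : ContDiffOn ℝ ∞ γ I)
    (hdist : ∀ s ∈ I, ∃ R, ∀ x, ‖f (x, s) - γ s‖ = R) :
    ∃ α β : ℝ → ℝ, ContDiffOn ℝ ∞ α I ∧ ContDiffOn ℝ ∞ β I ∧
      (∀ p ∈ prodDomain M₀ I, inner ℝ (deriv γ p.2) (n p) + deriv α p.2 = β p.2 * ρ p) ∧
      ∀ p ∈ prodDomain M₀ I, f p = γ p.2 + α p.2 • n p + β p.2 • T p := by
  have hfsm := fun p hp => hf.immersed.1.contMDiffAt hI (p := p) hp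
  let g : M₀ × ℝ → Amb m := fun p => f p - γ p.2
  have hg : ∀ p ∈ prodDomain M₀ I, ContMDiffAt ((𝓡 m).prod 𝓘(ℝ, ℝ)) 𝓘(ℝ, Amb m) ∞ g p :=
    fun p hp => (hfsm p hp).sub (contMDiffAt_comp_snd hI hγ hp)
  have hgX : ∀ p ∈ prodDomain M₀ I, ∀ X,
      vdiff (m := m) g p (X, 0) = vdiff (m := m) f p (X, 0) := by
    rintro ⟨x, s⟩ hp X
    exact (hasDerivAt_chartLine (hg _ hp) X).unique
      ((hasDerivAt_chartLine (hfsm _ hp) X).sub_const (γ s))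
  have hfn : ∀ p ∈ prodDomain M₀ I, ∀ X, inner ℝ (vdiff (m := m) f p (X, 0)) (n p) = 0 :=
    fun p hp X => (hf.gauss.2 p hp).2 (X, 0)
  have hfT : ∀ p ∈ prodDomain M₀ I, ∀ X, inner ℝ (vdiff (m := m) f p (X, 0)) (T p) = 0 := by
    intro p hp X
    have := hf.inner_vdiff_sDeriv_gauss hI hp X
    rw [h.sDeriv_n p hp, inner_smul_right] at this
    exact (mul_eq_zero.1 this).resolve_left (hρ p hp)
  have hfg : ∀ p ∈ prodDomain M₀ I, ∀ X, inner ℝ (vdiff (m := m) f p (X, 0)) (g p) = 0 := by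
    intro p hp X
    obtain ⟨R, hR⟩ := hdist p.2 hp.2
    have := inner_vdiff_add (hg p hp) (hg p hp) (c := R ^ 2)
      (fun x => by rw [real_inner_self_eq_norm_sq, hR x]) X
    rw [hgX p hp, real_inner_comm] at this
    linarith
  have hgeq : ∀ p ∈ prodDomain M₀ I,
      g p = inner ℝ (g p) (n p) • n p + inner ℝ (g p) (T p) • T p := fun p hp =>
    h.eq_add hp (hf.immersed.2 p hp) (hfn p hp) (hfT p hp) (hfg p hp)
  -- Stated for a general field `e` in order to be applied to `n`, giving `α`, and to `T`, giving
  -- `β`.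
  have hconst : ∀ {e : M₀ × ℝ → Amb m},
      (∀ p ∈ prodDomain M₀ I, ContMDiffAt ((𝓡 m).prod 𝓘(ℝ, ℝ)) 𝓘(ℝ, Amb m) ∞ e p) →
      (∀ p ∈ prodDomain M₀ I, ∀ X, inner ℝ (vdiff (m := m) f p (X, 0)) (e p) = 0) →
      (∀ p ∈ prodDomain M₀ I, ∀ X, inner ℝ (g p) (vdiff (m := m) e p (X, 0)) = 0) →
      (∀ p ∈ prodDomain M₀ I, ContMDiffAt ((𝓡 m).prod 𝓘(ℝ, ℝ)) 𝓘(ℝ, ℝ) ∞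
        (fun p => inner ℝ (g p) (e p)) p) ∧
      ∀ s ∈ I, ∀ x x' : M₀,
        (inner ℝ (g (x, s)) (e (x, s)) : ℝ) = inner ℝ (g (x', s)) (e (x', s)) := by
    intro e he h1 h2
    have hsm : ∀ p ∈ prodDomain M₀ I, ContMDiffAt ((𝓡 m).prod 𝓘(ℝ, ℝ)) 𝓘(ℝ, ℝ) ∞
        (fun p => inner ℝ (g p) (e p)) p := fun p hp =>
      ContMDiffAt.comp (g := fun q : Amb m × Amb m => inner ℝ q.1 q.2) p
        (contDiff_inner.contDiffAt.contMDiffAt) ((hg p hp).prodMk_space (he p hp))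
    refine ⟨hsm, fun s hs => eq_of_vdiff_eq_zero (fun x => hsm (x, s) ⟨trivial, hs⟩) ?_⟩
    intro x X
    have hp : (x, s) ∈ prodDomain M₀ I := ⟨trivial, hs⟩
    have e1 := (hasDerivAt_chartLine (hg _ hp) X).inner ℝ (hasDerivAt_chartLine (he _ hp) X)
    simp only [chartLine_zero] at e1
    rw [h2 _ hp, hgX _ hp, h1 _ hp, add_zero] at e1
    exact (hasDerivAt_chartLine (hsm _ hp) X).unique e1
  obtain ⟨hαs, hαc⟩ := hconst h.smooth_n hfn fun p hp X => by
    rw [hgeq p hp, inner_add_left, inner_smul_left, inner_smul_left,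
      real_inner_comm _ (n p), h.inner_vdiff_n hp, real_inner_comm _ (T p), h.inner_vdiff_T p hp,
      mul_zero, mul_zero, add_zero]
  obtain ⟨hβs, hβc⟩ := hconst h.smooth_T hfT fun p hp X => by
    rw [hgeq p hp, inner_add_left, inner_smul_left, inner_smul_left,
      real_inner_comm _ (n p), h.inner_vdiffT_n hp, real_inner_comm _ (T p), h.inner_vdiffT_T hp,
      mul_zero, mul_zero, add_zero]
  obtain ⟨x₀⟩ : Nonempty M₀ := inferInstance
  have hslice : ∀ {φ : M₀ × ℝ → ℝ},
      (∀ p ∈ prodDomain M₀ I, ContMDiffAt ((𝓡 m).prod 𝓘(ℝ, ℝ)) 𝓘(ℝ, ℝ) ∞ φ p) →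
      ContDiffOn ℝ ∞ (fun s => φ (x₀, s)) I := fun hφ s hs =>
    ((hφ (x₀, s) ⟨trivial, hs⟩).comp s
      (contMDiffAt_const.prodMk contMDiffAt_id)).contDiffAt.contDiffWithinAt
  have hα := hslice hαs
  have hβ := hslice hβs
  have hfeq : ∀ p ∈ prodDomain M₀ I, f p = γ p.2 +
      (inner ℝ (g (x₀, p.2)) (n (x₀, p.2)) : ℝ) • n p +
      (inner ℝ (g (x₀, p.2)) (T (x₀, p.2)) : ℝ) • T p := by
    rintro ⟨x, s⟩ hp
    rw [hαc s hp.2 x₀ x, hβc s hp.2 x₀ x, add_assoc, ← hgeq _ hp]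
    simp [g]
  refine ⟨_, _, hα, hβ, fun p hp => ?_, hfeq⟩
  have h1 := h.inner_sDeriv_combination hI hγ hα hβ hfeq hp
  rw [← vdiff_zero_one (hfsm p hp)] at h1
  have h2 : inner ℝ (vdiff (m := m) f p (0, 1)) (n p) = 0 := (hf.gauss.2 p hp).2 (0, 1)
  rw [h2] at h1
  linarith

end Main

end EnneperType

end

theorem mainTheorem8 (m : ℕ) (hm : 1 ≤ m)
    (M₀ : Type*) [TopologicalSpace M₀] [ChartedSpace (EuclideanSpace ℝ (Fin m)) M₀]
    [IsManifold (𝓡 m) ∞ M₀] [ConnectedSpace M₀]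
    (I : Set ℝ) (hIopen : IsOpen I) (hIconn : I.OrdConnected)
    (N : M₀ × ℝ → EnneperType.USphere m)
    (hN : IsLocalDiffeomorphOn ((𝓡 m).prod 𝓘(ℝ, ℝ)) (𝓡 (m + 1)) ∞ N
      (EnneperType.prodDomain M₀ I)) :
    -- orthogonality of the net for the metric induced by `N`, and its expression `g_s + ρ² ds²`
    (EnneperType.NetOrthogonalOn (EnneperType.toAmb N) (EnneperType.prodDomain M₀ I) ↔
      ∃ ρ : M₀ × ℝ → ℝ, EnneperType.MetricSplitsOn N ρ (EnneperType.prodDomain M₀ I)) ∧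
    -- direct statement
    (∀ ρ : M₀ × ℝ → ℝ, EnneperType.MetricSplitsOn N ρ (EnneperType.prodDomain M₀ I) →
      ∀ (γ : ℝ → EnneperType.Amb m) (α β : ℝ → ℝ), EnneperType.IsEnneperTriple N ρ I γ α β →
        EnneperType.IsEnneperOn (EnneperType.enneperMap N ρ γ α β) (EnneperType.toAmb N)
          (EnneperType.regularPoints (EnneperType.enneperMap N ρ γ α β)
            (EnneperType.prodDomain M₀ I)) ∧
        EnneperType.LeavesInSpheresCentred (EnneperType.enneperMap N ρ γ α β)
          (EnneperType.regularPoints (EnneperType.enneperMap N ρ γ α β)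
            (EnneperType.prodDomain M₀ I)) γ) ∧
    -- converse statement
    (∀ f : M₀ × ℝ → EnneperType.Amb m,
      EnneperType.IsEnneperOn f (EnneperType.toAmb N) (EnneperType.prodDomain M₀ I) →
        EnneperType.NetOrthogonalOn (EnneperType.toAmb N) (EnneperType.prodDomain M₀ I) ∧
        ∀ ρ : M₀ × ℝ → ℝ, EnneperType.MetricSplitsOn N ρ (EnneperType.prodDomain M₀ I) →
          -- any smooth choice `γ` of the centres of the hyperspheres gives a triple
          (∀ γ : ℝ → EnneperType.Amb m, ContDiffOn ℝ ∞ γ I →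
            EnneperType.LeavesInSpheresCentred f (EnneperType.prodDomain M₀ I) γ →
            ∃ α β : ℝ → ℝ, EnneperType.IsEnneperTriple N ρ I γ α β ∧
              ∀ p ∈ EnneperType.prodDomain M₀ I,
                f p = EnneperType.enneperMap N ρ γ α β p) ∧
          -- without a smooth choice of centres, `f` is of this form over an open dense subset of
          -- `I`, which contains each `s` such that `f (M₀ × {s})` lies in no affine hyperplane
          (∃ J : Set ℝ, IsOpen J ∧ J ⊆ I ∧ I ⊆ closure J ∧
            (∀ s ∈ I, (¬ ∃ (u : EnneperType.Amb m) (c : ℝ), u ≠ 0 ∧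
              ∀ x : M₀, inner ℝ u (f (x, s)) = c) → s ∈ J) ∧
            ∃ (γ : ℝ → EnneperType.Amb m) (α β : ℝ → ℝ),
              EnneperType.IsEnneperTriple N ρ J γ α β ∧
              ∀ p ∈ EnneperType.prodDomain M₀ J,
                f p = EnneperType.enneperMap N ρ γ α β p)) := by
  open EnneperType in
  refine ⟨⟨exists_metricSplitsOn hN, fun ⟨ρ, hρ⟩ => hρ.netOrthogonalOn⟩, ?_, ?_⟩
  · intro ρ hρ γ α β ⟨hγ, hα, hβ, heq⟩
    obtain ⟨-, h⟩ := hρ.isNetFrame hIopen hN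
    exact h.isEnneperOn hm hIopen hγ hα hβ heq fun p hp => enneperMap_eq hN γ α β hp
  · intro f hf
    refine ⟨hf.netOrthogonalOn_gauss hIopen, fun ρ hρ => ?_⟩
    obtain ⟨hne, h⟩ := hρ.isNetFrame hIopen hN
    -- Used with `J = I` when smooth centres are given, and with the dense set of
    -- `exists_smooth_centre` otherwise. Only constant distance to `γ s` is required, as the
    -- constructed centres come without a positive radius.
    have key : ∀ J ⊆ I, IsOpen J → ∀ γ : ℝ → Amb m, ContDiffOn ℝ ∞ γ J →
        (∀ s ∈ J, ∃ R, ∀ x, ‖f (x, s) - γ s‖ = R) →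
        ∃ α β : ℝ → ℝ, IsEnneperTriple N ρ J γ α β ∧
          ∀ p ∈ prodDomain M₀ J, f p = enneperMap N ρ γ α β p := by
      intro J hJ hJo γ hγ hdist
      have hsub : prodDomain M₀ J ⊆ prodDomain M₀ I := Set.prod_mono_right hJ
      obtain ⟨α, β, hα, hβ, heq, hfeq⟩ := (h.mono hJ).exists_triple hJo
        (fun p hp => hne p (hsub hp)) (hf.mono hsub) hγ hdist
      exact ⟨α, β, ⟨hγ, hα, hβ, heq⟩, fun p hp =>
        (hfeq p hp).trans (enneperMap_eq hN γ α β (hsub hp)).symm⟩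
    constructor
    · intro γ hγ hc
      refine key I subset_rfl hIopen γ hγ fun s hs => ?_
      obtain ⟨R, -, hR⟩ := hc s
      exact ⟨R, fun x => mem_sphere_iff_norm.1 (hR x ⟨trivial, hs⟩)⟩
    · obtain ⟨c, hc⟩ := hf.spherical
      obtain ⟨J, hJo, hJ, hdense, hspan, γ, hγ, hdist⟩ :=
        exists_smooth_centre (g := fun (x : M₀) s => f (x, s)) hIopen
          (fun x s hs => ((hf.immersed.1.contMDiffAt hIopen (p := (x, s)) ⟨trivial, hs⟩).comp s
            (contMDiffAt_const.prodMk contMDiffAt_id)).contDiffAt)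
          (fun s hs => by
            obtain ⟨R, -, hR⟩ := hc s
            exact ⟨c s, R, fun x => mem_sphere_iff_norm.1 (hR x ⟨trivial, hs⟩)⟩)
      exact ⟨J, hJo, hJ, hdense, hspan, γ, key J hJ hJo γ hγ hdist⟩
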